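/- Let $0<q<1$ and let $A$ be the symmetric operator on the complex Hilbert space $\ell^2(\mathbb{Z})$, with standard basis $(e_n)_{n\in\mathbb{Z}}$, whose domain is $\operatorname{span}\{e_n \mid n\in\mathbb{Z}\}$ and which acts by \[ A e_n = q^{-n+1}e_{n-1}+q^{-n}e_{n+1},\qquad n\in\mathbb{Z}. \] Then for every self-adjoint extension $A_t$ of $A$, \[ \operatorname{spec}_{ess}(A_t)=\operatorname{spec}_{c}(A_t)=\{0\}, \] and $0$ is not an eigenvalue of $A_t$. Here $\operatorname{spec}_{ess}(A_t)$ is the set of all points of the spectrum that are not isolated eigenvalues of finite multiplicity, and $\operatorname{spec}_{c}(A_t)$ is the set of all points $\lambda$ of the spectrum such that $A_t-\lambda$ is injective with dense range. -/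

import Mathlib

noncomputable section

namespace UnboundedOperator

variable {H : Type*} [NormedAddCommGroup H] [InnerProductSpace ℂ H]

/-- The resolvent set of a partially defined operator `T`: all `z` for which `T - z`, as a map from
the domain of `T` to the whole space, has an everywhere defined bounded two-sided inverse. -/
def resolventSet (T : H →ₗ.[ℂ] H) : Set ℂ :=
  {z | ∃ R : H →L[ℂ] H,
    (∀ y : H, ∃ hy : R y ∈ T.domain, T ⟨R y, hy⟩ - z • R y = y) ∧
    ∀ x : T.domain, R (T x - z • (x : H)) = (x : H)}

/-- The spectrum of `T`. -/
def spec (T : H →ₗ.[ℂ] H) : Set ℂ := (resolventSet T)ᶜ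

/-- The kernel of `T - z`, as a subspace of the ambient space. -/
def eigenspace (T : H →ₗ.[ℂ] H) (z : ℂ) : Submodule ℂ H :=
  (LinearMap.ker (T.toFun - z • T.domain.subtype)).map T.domain.subtype

/-- The point spectrum of `T`: the set of its eigenvalues. -/
def pointSpec (T : H →ₗ.[ℂ] H) : Set ℂ := {z | eigenspace T z ≠ ⊥}

/-- The continuous spectrum of `T`: the points `z` of the spectrum for which `T - z` is injective
and has dense range. -/
def contSpec (T : H →ₗ.[ℂ] H) : Set ℂ :=
  {z | z ∈ spec T ∧ eigenspace T z = ⊥ ∧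
    Dense (Set.range fun x : T.domain => T x - z • (x : H))}

/-- The discrete spectrum of a self-adjoint operator `T`: the isolated points of the spectrum that
are eigenvalues of finite multiplicity. -/
def discreteSpec (T : H →ₗ.[ℂ] H) : Set ℂ :=
  {z | z ∈ pointSpec T ∧ FiniteDimensional ℂ (eigenspace T z) ∧
    ∃ ε : ℝ, 0 < ε ∧ ∀ w ∈ spec T, dist w z < ε → w = z}

/-- The essential spectrum of a self-adjoint operator `T`: the complement of the discrete spectrum
in the spectrum. -/
def essSpec (T : H →ₗ.[ℂ] H) : Set ℂ := spec T \ discreteSpec T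

theorem mem_eigenspace_iff (T : H →ₗ.[ℂ] H) (z : ℂ) (x : H) :
    x ∈ eigenspace T z ↔ ∃ hx : x ∈ T.domain, T ⟨x, hx⟩ = z • x := by
  simp only [eigenspace, Submodule.mem_map, LinearMap.mem_ker, LinearMap.sub_apply,
    LinearMap.smul_apply, Submodule.subtype_apply, sub_eq_zero]
  constructor
  · rintro ⟨y, hy, rfl⟩
    exact ⟨y.2, hy⟩
  · rintro ⟨hx, h⟩
    exact ⟨⟨x, hx⟩, h, rfl⟩

end UnboundedOperator

namespace JacobiA

/-- The complex Hilbert space `ℓ²(ℤ)`. -/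
abbrev L2Z : Type := lp (fun _ : ℤ => ℂ) 2

/-- The standard basis vector `e n` of `ℓ²(ℤ)`. -/
def e (n : ℤ) : L2Z := lp.single 2 n (1 : ℂ)

theorem e_apply (n m : ℤ) : (e n : ℤ → ℂ) m = if m = n then 1 else 0 := by
  simp [e, Pi.single_apply]

theorem linearIndependent_e : LinearIndependent ℂ e := by
  rw [linearIndependent_iff']
  intro s g hg i hi
  have h := congrArg (fun f : L2Z => (f : ℤ → ℂ) i) hg
  simp only [lp.coeFn_sum, Finset.sum_apply, lp.coeFn_smul, Pi.smul_apply, e_apply] at h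
  simpa [hi] using h

/-- The operator `A = A(q)` with domain `span {e n | n ∈ ℤ}`, determined by linearity from
`A e n = q^(-n+1) e (n-1) + q^(-n) e (n+1)`. -/
def A (q : ℝ) : L2Z →ₗ.[ℂ] L2Z where
  domain := Submodule.span ℂ (Set.range e)
  toFun := (Module.Basis.span linearIndependent_e).constr ℂ fun n : ℤ =>
    ((q : ℂ) ^ (-n + 1)) • e (n - 1) + ((q : ℂ) ^ (-n)) • e (n + 1)

theorem e_mem_domain (q : ℝ) (n : ℤ) : e n ∈ (A q).domain :=
  Submodule.subset_span ⟨n, rfl⟩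

theorem A_apply_e (q : ℝ) (n : ℤ) :
    A q ⟨e n, e_mem_domain q n⟩ =
      ((q : ℂ) ^ (-n + 1)) • e (n - 1) + ((q : ℂ) ^ (-n)) • e (n + 1) := by
  have h : (⟨e n, e_mem_domain q n⟩ : (A q).domain) =
      Module.Basis.span linearIndependent_e n :=
    (Module.Basis.span_apply linearIndependent_e n).symm
  rw [h]
  exact (Module.Basis.span linearIndependent_e).constr_basis ℂ _ n

end JacobiA

end

/-! For `z ≠ 0`, a bounded sequence that `T - z` sends to a null sequence is relatively compact
(`isProperAt_of_ne_zero`). On the left half-line the weights are geometrically small, so `T x` is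
too, and `x` is `z⁻¹ • T x` up to the null sequence. On the right the weights blow up, and dividing
the recurrence by them forces geometric decay of `x`. Both bounds are uniform, so up to a null
sequence everything lies in a compact set of dominated sequences.

For self-adjoint `T`, this properness near a spectral point makes it an isolated eigenvalue of
finite multiplicity (`mem_discreteSpec_of_isProperAt`). At `0`, the vectors `e (-k)` are approximate
null vectors, while a genuine null vector would grow geometrically to the left. Dense range at `0`
then follows from self-adjointness. -/

noncomputable section

open Filter Topology

/-! ### Properness and the discrete spectrum of self-adjoint operators -/

namespace UnboundedOperator

variable {H : Type*} [NormedAddCommGroup H] [InnerProductSpace ℂ H]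

/-- `T - z` is proper on bounded sequences: a bounded sequence which `T - z` sends to a null
sequence has a convergent subsequence. -/
def IsProperAt (T : H →ₗ.[ℂ] H) (z : ℂ) : Prop :=
  ∀ x : ℕ → T.domain, (∀ k, ‖(x k : H)‖ ≤ 1) →
    Tendsto (fun k => T (x k) - z • (x k : H)) atTop (𝓝 0) →
    ∃ (a : H) (φ : ℕ → ℕ), StrictMono φ ∧ Tendsto (fun k => (x (φ k) : H)) atTop (𝓝 a)

theorem mem_pointSpec_iff (T : H →ₗ.[ℂ] H) (z : ℂ) :
    z ∈ pointSpec T ↔ ∃ x : T.domain, (x : H) ≠ 0 ∧ T x = z • (x : H) := by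
  change eigenspace T z ≠ ⊥ ↔ _
  rw [Submodule.ne_bot_iff]
  constructor
  · rintro ⟨x, hx, h0⟩
    obtain ⟨hd, h⟩ := (mem_eigenspace_iff T z x).1 hx
    exact ⟨⟨x, hd⟩, h0, h⟩
  · rintro ⟨x, h0, h⟩
    exact ⟨x, (mem_eigenspace_iff T z x).2 ⟨x.2, h⟩, h0⟩

/-- The linear map `T - z` on the domain of `T`. -/
def shift (T : H →ₗ.[ℂ] H) (z : ℂ) : T.domain →ₗ[ℂ] H := T.toFun - z • T.domain.subtype

theorem shift_apply (T : H →ₗ.[ℂ] H) (z : ℂ) (x : T.domain) :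
    shift T z x = T x - z • (x : H) := rfl

theorem mem_pointSpec_of_shift_eq_zero {T : H →ₗ.[ℂ] H} {z : ℂ} {x : T.domain}
    (hx : (x : H) ≠ 0) (h : shift T z x = 0) : z ∈ pointSpec T :=
  (mem_pointSpec_iff T z).2 ⟨x, hx, sub_eq_zero.1 h⟩

/-- A closed operator is closed under limits of sequences along which `T - z` converges. -/
theorem exists_shift_eq_of_tendsto {T : H →ₗ.[ℂ] H} (hT : T.IsClosed) {z : ℂ}
    {x : ℕ → T.domain} {a b : H} (ha : Tendsto (fun k => (x k : H)) atTop (𝓝 a))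
    (hb : Tendsto (fun k => shift T z (x k)) atTop (𝓝 b)) :
    ∃ h : a ∈ T.domain, shift T z ⟨a, h⟩ = b := by
  have hTx : Tendsto (fun k => T (x k)) atTop (𝓝 (b + z • a)) := by
    refine (hb.add (ha.const_smul z)).congr fun k => ?_
    simp [shift_apply]
  have hmem : (a, b + z • a) ∈ (T.graph : Set (H × H)) :=
    hT.mem_of_tendsto (ha.prodMk_nhds hTx) (Eventually.of_forall fun k => T.mem_graph (x k))
  obtain ⟨y, hy, hy'⟩ := (LinearPMap.mem_graph_iff T).1 hmem
  dsimp only at hy hy'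
  subst hy
  exact ⟨y.2, by simp [shift_apply, hy']⟩

/-- Otherwise unit vectors with `T - z` tending to zero would subconverge, by closedness, to a unit
eigenvector. -/
theorem bounded_below_of_isProperAt {T : H →ₗ.[ℂ] H} (hT : T.IsClosed) {z : ℂ}
    (hp : IsProperAt T z) (hz : z ∉ pointSpec T) :
    ∃ C : ℝ, 0 ≤ C ∧ ∀ x : T.domain, ‖(x : H)‖ ≤ C * ‖shift T z x‖ := by
  by_contra! hcon
  have hk : ∀ k : ℕ, ∃ x : T.domain, ‖(x : H)‖ = 1 ∧ ‖shift T z x‖ ≤ 1 / ((k : ℝ) + 1) := by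
    intro k
    obtain ⟨x, hx⟩ := hcon ((k : ℝ) + 1) (by positivity)
    have hpos : 0 < ‖(x : H)‖ := lt_of_le_of_lt (by positivity) hx
    have hn : ‖((‖(x : H)‖⁻¹ : ℝ) : ℂ)‖ = ‖(x : H)‖⁻¹ := by
      rw [Complex.norm_real, Real.norm_of_nonneg (by positivity)]
    refine ⟨((‖(x : H)‖⁻¹ : ℝ) : ℂ) • x, ?_, ?_⟩
    · rw [Submodule.coe_smul, norm_smul, hn, inv_mul_cancel₀ hpos.ne']
    · rw [map_smul, norm_smul, hn, le_div_iff₀ (by positivity), mul_assoc,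
        inv_mul_le_iff₀ hpos]
      linarith
  choose x hx1 hx2 using hk
  have hlim : Tendsto (fun k => shift T z (x k)) atTop (𝓝 0) :=
    squeeze_zero_norm hx2 tendsto_one_div_add_atTop_nhds_zero_nat
  obtain ⟨a, φ, hφ, ha⟩ := hp x (fun k => (hx1 k).le) hlim
  obtain ⟨hd, h0⟩ := exists_shift_eq_of_tendsto hT ha (hlim.comp hφ.tendsto_atTop)
  have hna : ‖a‖ = 1 :=
    tendsto_nhds_unique ha.norm (by simp [hx1])
  refine hz (mem_pointSpec_of_shift_eq_zero (x := ⟨a, hd⟩) ?_ h0)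
  rw [← norm_ne_zero_iff]
  simp [hna]

/-- Properness makes the closed unit ball of the eigenspace sequentially compact, so Riesz's theorem
applies. -/
theorem finiteDimensional_eigenspace_of_isProperAt {T : H →ₗ.[ℂ] H} (hT : T.IsClosed) {z : ℂ}
    (hp : IsProperAt T z) : FiniteDimensional ℂ (eigenspace T z) := by
  refine FiniteDimensional.of_isCompact_closedBall₀ ℂ one_pos (IsSeqCompact.isCompact ?_)
  intro u hu
  have hd : ∀ k, ∃ h : (u k : H) ∈ T.domain, T ⟨u k, h⟩ = z • (u k : H) := fun k =>
    (mem_eigenspace_iff T z _).1 (u k).2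
  choose hd hs using hd
  have hs' : ∀ k, shift T z ⟨u k, hd k⟩ = 0 := fun k => sub_eq_zero.2 (hs k)
  have hu1 : ∀ k, ‖(u k : H)‖ ≤ 1 := fun k => by simpa using hu k
  obtain ⟨a, φ, hφ, ha⟩ := hp (fun k => ⟨u k, hd k⟩) hu1
    (by simp only [← shift_apply, hs', tendsto_const_nhds])
  obtain ⟨had, h0⟩ := exists_shift_eq_of_tendsto (z := z) (b := 0) hT ha
    (by simp only [hs', tendsto_const_nhds])
  refine ⟨⟨a, (mem_eigenspace_iff T z a).2 ⟨had, sub_eq_zero.1 h0⟩⟩, ?_, φ, hφ, ?_⟩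
  · rw [mem_closedBall_zero_iff]
    exact le_of_tendsto' ha.norm fun k => hu1 (φ k)
  · exact tendsto_subtype_rng.2 ha

variable [CompleteSpace H]

theorem inner_apply_comm {T : H →ₗ.[ℂ] H} (hT : IsSelfAdjoint T) (x y : T.domain) :
    inner ℂ (T x) (y : H) = inner ℂ (x : H) (T y) := by
  have h := LinearPMap.adjoint_isFormalAdjoint hT.dense_domain
  rw [LinearPMap.isSelfAdjoint_def.1 hT] at h
  exact h x y

/-- A vector orthogonal to the range of `T - z` is in the kernel of `T - z̄`. -/
theorem exists_apply_eq_of_orthogonal_range {T : H →ₗ.[ℂ] H} (hT : IsSelfAdjoint T) {z : ℂ}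
    {v : H} (hv : ∀ x : T.domain, inner ℂ v (shift T z x) = 0) :
    ∃ h : v ∈ T.domain, T ⟨v, h⟩ = (starRingEnd ℂ z) • v := by
  have hv' : ∀ x : T.domain, inner ℂ ((starRingEnd ℂ z) • v) (x : H) = inner ℂ v (T x) := by
    intro x
    have h := hv x
    rw [shift_apply, inner_sub_right, sub_eq_zero, inner_smul_right] at h
    rw [inner_smul_left, h, Complex.conj_conj]
  have hmem : v ∈ T.adjoint.domain := LinearPMap.mem_adjoint_domain_of_exists v ⟨_, hv'⟩
  have happ := LinearPMap.adjoint_apply_eq hT.dense_domain ⟨v, hmem⟩ hv'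
  have hT' := LinearPMap.isSelfAdjoint_def.1 hT
  have hgraph : (v, (starRingEnd ℂ z) • v) ∈ T.adjoint.graph :=
    (LinearPMap.mem_graph_iff _).2 ⟨⟨v, hmem⟩, rfl, happ⟩
  rw [hT'] at hgraph
  obtain ⟨y, hy, hy'⟩ := (LinearPMap.mem_graph_iff T).1 hgraph
  dsimp only at hy hy'
  subst hy
  exact ⟨y.2, hy'⟩

theorem inner_eq_zero_of_eigenvectors {T : H →ₗ.[ℂ] H} (hT : IsSelfAdjoint T) {z w : ℂ}
    {x y : T.domain} (hx : T x = z • (x : H)) (hy : T y = w • (y : H))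
    (h : starRingEnd ℂ z ≠ w) : inner ℂ (x : H) (y : H) = 0 := by
  have := inner_apply_comm hT x y
  rw [hx, hy, inner_smul_left, inner_smul_right, ← sub_eq_zero, ← sub_mul] at this
  exact (mul_eq_zero.1 this).resolve_left (sub_ne_zero.2 h)

theorem conj_eq_of_mem_pointSpec {T : H →ₗ.[ℂ] H} (hT : IsSelfAdjoint T) {z : ℂ}
    (hz : z ∈ pointSpec T) : starRingEnd ℂ z = z := by
  obtain ⟨x, hx0, hx⟩ := (mem_pointSpec_iff T z).1 hz
  by_contra h
  exact hx0 (inner_self_eq_zero.1 (inner_eq_zero_of_eigenvectors hT hx hx h))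

theorem topologicalClosure_range_shift {T : H →ₗ.[ℂ] H} (hT : IsSelfAdjoint T) {z : ℂ}
    (hz : z ∉ pointSpec T) : (LinearMap.range (shift T z)).topologicalClosure = ⊤ := by
  rw [Submodule.topologicalClosure_eq_top_iff, Submodule.eq_bot_iff]
  intro v hv
  by_contra hv0
  obtain ⟨hd, h⟩ := exists_apply_eq_of_orthogonal_range hT (z := z) (v := v) fun x =>
    (Submodule.mem_orthogonal' _ v).1 hv _ ⟨x, rfl⟩
  have hmem : starRingEnd ℂ z ∈ pointSpec T := (mem_pointSpec_iff T _).2 ⟨⟨v, hd⟩, hv0, h⟩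
  have := conj_eq_of_mem_pointSpec hT hmem
  rw [Complex.conj_conj] at this
  exact hz (this ▸ hmem)

theorem dense_range_of_notMem_pointSpec {T : H →ₗ.[ℂ] H} (hT : IsSelfAdjoint T) {z : ℂ}
    (hz : z ∉ pointSpec T) : Dense (Set.range fun x : T.domain => T x - z • (x : H)) := by
  have := Submodule.dense_iff_topologicalClosure_eq_top.2 (topologicalClosure_range_shift hT hz)
  rwa [LinearMap.coe_range] at this

/-- The lower bound makes `T - z` injective with closed range; the range is also dense, and the same
bound controls the inverse. -/
theorem mem_resolventSet_of_isProperAt {T : H →ₗ.[ℂ] H} (hT : IsSelfAdjoint T) {z : ℂ}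
    (hp : IsProperAt T z) (hz : z ∉ pointSpec T) : z ∈ resolventSet T := by
  obtain ⟨C, hC0, hC⟩ := bounded_below_of_isProperAt hT.isClosed hp hz
  have hinj : Function.Injective (shift T z) := by
    rw [injective_iff_map_eq_zero]
    intro x hx
    have := hC x
    rw [hx, norm_zero, mul_zero, norm_le_zero_iff] at this
    exact Subtype.ext this
  have hclosed : IsClosed (LinearMap.range (shift T z) : Set H) := by
    refine IsSeqClosed.isClosed fun y b hy hb => ?_
    choose x hx using hy
    have hcau : CauchySeq fun k => (x k : H) := by
      rw [Metric.cauchySeq_iff]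
      intro ε hε
      obtain ⟨N, hN⟩ := Metric.cauchySeq_iff.1 hb.cauchySeq (ε / (C + 1)) (by positivity)
      refine ⟨N, fun m hm n hn => ?_⟩
      have h1 := hN m hm n hn
      have h2 := hC (x m - x n)
      rw [map_sub, hx, hx, Submodule.coe_sub, ← dist_eq_norm, ← dist_eq_norm] at h2
      rw [lt_div_iff₀ (by positivity)] at h1
      nlinarith [dist_nonneg (x := y m) (y := y n)]
    obtain ⟨a, ha⟩ := cauchySeq_tendsto_of_complete hcau
    obtain ⟨hd, h⟩ := exists_shift_eq_of_tendsto (z := z) hT.isClosed ha (by simpa only [hx] using hb)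
    exact ⟨⟨a, hd⟩, h⟩
  have hsurj : Function.Surjective (shift T z) := by
    rw [← LinearMap.range_eq_top, ← hclosed.submodule_topologicalClosure_eq]
    exact topologicalClosure_range_shift hT hz
  let E := LinearEquiv.ofBijective (shift T z) ⟨hinj, hsurj⟩
  have hE : ∀ y, shift T z (E.symm y) = y := fun y => E.apply_symm_apply y
  refine ⟨(T.domain.subtype ∘ₗ E.symm.toLinearMap).mkContinuous C fun y => ?_,
    fun y => ⟨(E.symm y).2, hE y⟩, fun x => ?_⟩
  · have := hC (E.symm y)
    rwa [hE] at this
  · exact congrArg Subtype.val (E.symm_apply_apply x)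

/-- Unit eigenvectors for eigenvalues accumulating at `z` would subconverge to a unit vector in the
kernel of `T - z`, which is orthogonal to all of them and hence to itself. -/
theorem exists_pointSpec_isolated {T : H →ₗ.[ℂ] H} (hT : IsSelfAdjoint T) {z : ℂ}
    (hp : IsProperAt T z) : ∃ ε : ℝ, 0 < ε ∧ ∀ w ∈ pointSpec T, dist w z < ε → w = z := by
  by_contra! hcon
  have hk : ∀ k : ℕ, ∃ w : ℂ, ∃ x : T.domain, w ≠ z ∧ dist w z < 1 / ((k : ℝ) + 1) ∧
      ‖(x : H)‖ = 1 ∧ T x = w • (x : H) ∧ starRingEnd ℂ w = w := by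
    intro k
    obtain ⟨w, hw, hd, hne⟩ := hcon (1 / ((k : ℝ) + 1)) (by positivity)
    obtain ⟨x, hx0, hx⟩ := (mem_pointSpec_iff T w).1 hw
    have hpos : 0 < ‖(x : H)‖ := norm_pos_iff.2 hx0
    refine ⟨w, ((‖(x : H)‖⁻¹ : ℝ) : ℂ) • x, hne, hd, ?_, ?_, conj_eq_of_mem_pointSpec hT hw⟩
    · rw [Submodule.coe_smul, norm_smul, Complex.norm_real, Real.norm_of_nonneg (by positivity),
        inv_mul_cancel₀ hpos.ne']
    · rw [LinearPMap.map_smul, hx, Submodule.coe_smul, smul_comm]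
  choose w x hne hd hx1 hx hreal using hk
  have hlim : Tendsto (fun k => shift T z (x k)) atTop (𝓝 0) := by
    refine squeeze_zero_norm (fun k => ?_) tendsto_one_div_add_atTop_nhds_zero_nat
    rw [shift_apply, hx, ← sub_smul, norm_smul, hx1, mul_one, ← dist_eq_norm]
    exact (hd k).le
  obtain ⟨a, φ, hφ, ha⟩ := hp x (fun k => (hx1 k).le) hlim
  obtain ⟨had, h0⟩ := exists_shift_eq_of_tendsto hT.isClosed ha (hlim.comp hφ.tendsto_atTop)
  have hna : ‖a‖ = 1 := tendsto_nhds_unique ha.norm (by simp [hx1])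
  have horth : ∀ k, inner ℂ (x (φ k) : H) a = 0 := fun k =>
    inner_eq_zero_of_eigenvectors hT (x := x (φ k)) (y := ⟨a, had⟩) (hx _) (sub_eq_zero.1 h0)
      (by rw [hreal]; exact hne _)
  have haa : inner ℂ a a = 0 :=
    tendsto_nhds_unique (ha.inner tendsto_const_nhds) (by simp [horth])
  rw [inner_self_eq_zero] at haa
  simp [haa] at hna

theorem mem_pointSpec_of_mem_spec {T : H →ₗ.[ℂ] H} (hT : IsSelfAdjoint T) {z : ℂ}
    (hp : IsProperAt T z) (hz : z ∈ spec T) : z ∈ pointSpec T := by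
  by_contra h
  exact hz (mem_resolventSet_of_isProperAt hT hp h)

/-- If `T` is self-adjoint and `T - z` is proper for all `z` near a point `w` of the spectrum, then
`w` is an isolated eigenvalue of finite multiplicity. -/
theorem mem_discreteSpec_of_isProperAt {T : H →ₗ.[ℂ] H} (hT : IsSelfAdjoint T) {w : ℂ}
    (hp : ∀ᶠ z in 𝓝 w, IsProperAt T z) (hw : w ∈ spec T) : w ∈ discreteSpec T := by
  have hpw := hp.self_of_nhds
  obtain ⟨ε, hε, hiso⟩ := exists_pointSpec_isolated hT hpw
  obtain ⟨δ, hδ, hball⟩ := Metric.eventually_nhds_iff.1 hp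
  refine ⟨mem_pointSpec_of_mem_spec hT hpw hw,
    finiteDimensional_eigenspace_of_isProperAt hT.isClosed hpw, min ε δ, lt_min hε hδ, ?_⟩
  intro v hv hd
  exact hiso v (mem_pointSpec_of_mem_spec hT (hball (hd.trans_le (min_le_right _ _))) hv)
    (hd.trans_le (min_le_left _ _))

end UnboundedOperator


/-! ### Compactness and geometric decay of sequences -/

/-- The elements of `ℓ²` dominated by a fixed square-summable sequence form a compact set. -/
theorem lp.isCompact_setOf_norm_apply_le {ι : Type*} {g : ι → ℝ}
    (hg : Summable fun i => g i ^ 2) :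
    IsCompact {u : lp (fun _ : ι => ℂ) 2 | ∀ i, ‖u i‖ ≤ g i} := by
  have h2 : (0 : ℝ) < (2 : ENNReal).toReal := by norm_num
  -- The product of discs is compact by Tychonoff; dominated convergence makes its inclusion into
  -- `ℓ²` norm continuous.
  let K : Set (ι → ℂ) := Set.pi Set.univ fun i => Metric.closedBall 0 (g i)
  have hK : IsCompact K := isCompact_univ_pi fun i => isCompact_closedBall 0 (g i)
  have hKg : ∀ u ∈ K, ∀ i, ‖u i‖ ≤ g i := fun u hu i => by simpa using hu i trivial
  have hgm : Memℓp g 2 := memℓp_gen (by simpa using hg)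
  let F : K → lp (fun _ : ι => ℂ) 2 := fun u => ⟨(u : ι → ℂ), hgm.mono (hKg u u.2)⟩
  have hF_apply : ∀ (u : K) (i : ι), F u i = (u : ι → ℂ) i := fun u i => rfl
  have hF : Continuous F := by
    rw [continuous_iff_continuousAt]
    intro v
    have hsq : Tendsto (fun u : K => ‖F u - F v‖ ^ 2) (𝓝 v) (𝓝 0) := by
      have hnorm : ∀ u : K, ‖F u - F v‖ ^ 2 = ∑' i, ‖(u : ι → ℂ) i - (v : ι → ℂ) i‖ ^ 2 := by
        intro u
        have := lp.norm_rpow_eq_tsum h2 (F u - F v)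
        simpa only [ENNReal.toReal_ofNat, Real.rpow_ofNat, lp.coeFn_sub, Pi.sub_apply, hF_apply]
          using this
      simp only [hnorm]
      have := tendsto_tsum_of_dominated_convergence (𝓕 := 𝓝 v)
        (f := fun (u : K) i => ‖(u : ι → ℂ) i - (v : ι → ℂ) i‖ ^ 2) (g := fun _ => (0 : ℝ))
        (bound := fun i => 4 * g i ^ 2) (hg.mul_left 4) (fun i => ?_)
        (Eventually.of_forall fun u i => ?_)
      · simpa using this
      · have hc : Continuous fun u : K => ‖(u : ι → ℂ) i - (v : ι → ℂ) i‖ ^ 2 :=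
          ((((continuous_apply i).comp continuous_subtype_val).sub continuous_const).norm).pow 2
        simpa using hc.tendsto v
      · rw [Real.norm_of_nonneg (by positivity)]
        have h1 := hKg u u.2 i
        have h3 := hKg v v.2 i
        have h4 := norm_sub_le ((u : ι → ℂ) i) ((v : ι → ℂ) i)
        nlinarith [norm_nonneg ((u : ι → ℂ) i - (v : ι → ℂ) i)]
    rw [ContinuousAt, tendsto_iff_norm_sub_tendsto_zero]
    have := hsq.sqrt
    simpa [Real.sqrt_sq (norm_nonneg _)] using this
  have := isCompact_iff_compactSpace.1 hK
  convert isCompact_range hF using 1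
  ext u
  constructor
  · intro hu
    exact ⟨⟨fun i => u i, fun i _ => by simpa using hu i⟩, rfl⟩
  · rintro ⟨w, rfl⟩ i
    exact hKg w w.2 i

theorem summable_sq_mul_pow_natAbs (D : ℝ) {r : ℝ} (hr0 : 0 ≤ r) (hr1 : r < 1) :
    Summable fun n : ℤ => (D * r ^ n.natAbs) ^ 2 := by
  have h : Summable fun n : ℕ => (D * r ^ n) ^ 2 := by
    have hs := (summable_geometric_of_lt_one (sq_nonneg r) (by nlinarith)).mul_left (D ^ 2)
    refine hs.congr fun n => ?_
    rw [mul_pow, ← pow_mul, ← pow_mul, mul_comm 2 n]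
  exact Summable.of_nat_of_neg (by simpa using h) (by simpa using h)

/-- A two-step recursive inequality with geometric forcing forces geometric decay. -/
theorem le_mul_pow_of_two_step {q M : ℝ} (hq0 : 0 < q) (hq1 : q < 1) (hM : 1 ≤ M)
    {u : ℕ → ℝ} (h0 : u 0 ≤ 1) (h1 : u 1 ≤ 1)
    (h : ∀ n, u (n + 2) ≤ q * u n + M * q ^ (n + 1)) (n : ℕ) :
    u n ≤ 4 * M / (1 - q) ^ 2 * ((1 + q) / 2) ^ n := by
  set C := 4 * M / (1 - q) ^ 2 with hC
  have hq : 0 < (1 - q) ^ 2 := by nlinarith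
  have hCM : C * (1 - q) ^ 2 = 4 * M := div_mul_cancel₀ _ hq.ne'
  have hC4 : 4 ≤ C := by
    rw [hC, le_div_iff₀ hq]
    nlinarith
  induction n using Nat.strong_induction_on with
  | _ n ih =>
    match n with
    | 0 => simp; linarith
    | 1 => simp; nlinarith
    | n + 2 =>
      have hn := ih n (by omega)
      have hp : q ^ (n + 1) ≤ ((1 + q) / 2) ^ n :=
        (pow_le_pow_of_le_one hq0.le hq1.le (Nat.le_succ n)).trans
          (pow_le_pow_left₀ hq0.le (by linarith) n)
      -- `C` is chosen for this: `((1 + q) / 2) ^ 2 - q = (1 - q) ^ 2 / 4`, which times `C` is `M`.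
      have hstep : C * ((1 + q) / 2) ^ (n + 2) =
          q * (C * ((1 + q) / 2) ^ n) + M * ((1 + q) / 2) ^ n := by
        rw [pow_add]
        linear_combination (((1 + q) / 2) ^ n / 4) * hCM
      calc u (n + 2) ≤ q * u n + M * q ^ (n + 1) := h n
        _ ≤ q * (C * ((1 + q) / 2) ^ n) + M * ((1 + q) / 2) ^ n := by gcongr
        _ = _ := hstep.symm

/-! ### The difference operator and its self-adjoint extensions -/

namespace JacobiA

open UnboundedOperator

theorem norm_e (n : ℤ) : ‖e n‖ = 1 := by
  simp [e, lp.norm_single]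

theorem inner_e_left (n : ℤ) (x : L2Z) : inner ℂ (e n) x = x n := by
  simp [e, lp.inner_single_left]

theorem norm_apply_le (x : L2Z) (n : ℤ) : ‖x n‖ ≤ ‖x‖ :=
  lp.norm_apply_le_norm (by norm_num) x n

section Extension

variable {q : ℝ} {T : L2Z →ₗ.[ℂ] L2Z}

theorem extension_apply_e (hext : A q ≤ T) (n : ℤ) :
    T ⟨e n, hext.1 (e_mem_domain q n)⟩ =
      ((q : ℂ) ^ (-n + 1)) • e (n - 1) + ((q : ℂ) ^ (-n)) • e (n + 1) := by
  rw [← A_apply_e]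
  exact (hext.2 rfl).symm

/-- A symmetric extension of `A` acts on its domain by the formal difference expression. -/
theorem extension_apply_apply (hext : A q ≤ T) (hsa : IsSelfAdjoint T) (x : T.domain) (n : ℤ) :
    (T x) n = (q : ℂ) ^ (-n + 1) * (x : L2Z) (n - 1) + (q : ℂ) ^ (-n) * (x : L2Z) (n + 1) := by
  have h := inner_apply_comm hsa ⟨e n, hext.1 (e_mem_domain q n)⟩ x
  rw [extension_apply_e hext, inner_add_left, inner_smul_left, inner_smul_left, inner_e_left,
    inner_e_left, inner_e_left] at h
  rw [← h]
  simp only [map_zpow₀, Complex.conj_ofReal]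

theorem zero_notMem_pointSpec (hq0 : 0 < q) (hq1 : q < 1) (hext : A q ≤ T)
    (hsa : IsSelfAdjoint T) : (0 : ℂ) ∉ pointSpec T := by
  rw [mem_pointSpec_iff]
  rintro ⟨x, hx0, hx⟩
  have hqc : (q : ℂ) ≠ 0 := by exact_mod_cast hq0.ne'
  have hrec : ∀ n : ℤ, (x : L2Z) (n + 1) = -(q * (x : L2Z) (n - 1)) := by
    intro n
    have h := extension_apply_apply hext hsa x n
    rw [hx, zero_smul, lp.coeFn_zero, Pi.zero_apply, zpow_add₀ hqc, zpow_one, mul_assoc,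
      ← mul_add] at h
    have := (mul_eq_zero.1 h.symm).resolve_left (zpow_ne_zero _ hqc)
    linear_combination this
  have hnorm : ∀ (k : ℕ) (n : ℤ), ‖(x : L2Z) n‖ = q ^ k * ‖(x : L2Z) (n - 2 * k)‖ := by
    intro k
    induction k with
    | zero => simp
    | succ k ih =>
      intro n
      have h := hrec (n - 2 * k - 1)
      rw [ih n, show n - 2 * k = n - 2 * k - 1 + 1 by ring, h, norm_neg, norm_mul,
        Complex.norm_real, Real.norm_of_nonneg hq0.le, pow_succ, mul_assoc]
      rw [show n - 2 * (k : ℤ) - 1 - 1 = n - 2 * ((k + 1 : ℕ) : ℤ) by push_cast; ring]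
  refine hx0 (lp.ext (funext fun n => ?_))
  rw [lp.coeFn_zero, Pi.zero_apply, ← norm_le_zero_iff]
  have hlim : Tendsto (fun k : ℕ => q ^ k * ‖(x : L2Z)‖) atTop (𝓝 0) := by
    simpa using (tendsto_pow_atTop_nhds_zero_of_lt_one hq0.le hq1).mul_const ‖(x : L2Z)‖
  refine ge_of_tendsto' hlim fun k => ?_
  rw [hnorm k n]
  gcongr
  exact norm_apply_le _ _

theorem zero_mem_spec (hq0 : 0 < q) (hq1 : q < 1) (hext : A q ≤ T) : (0 : ℂ) ∈ spec T := by
  rintro ⟨R, -, hR⟩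
  have hbound : ∀ k : ℕ, 1 ≤ ‖R‖ * (2 * q ^ k) := by
    intro k
    have h := hR ⟨e (-k), hext.1 (e_mem_domain q _)⟩
    rw [zero_smul, sub_zero, extension_apply_e hext] at h
    calc (1 : ℝ) = ‖e (-k)‖ := (norm_e _).symm
      _ ≤ ‖R‖ * ‖(q : ℂ) ^ (-(-(k : ℤ)) + 1) • e (-k - 1) + (q : ℂ) ^ (-(-(k : ℤ))) • e (-k + 1)‖ := by
        exact (congrArg norm h).symm.le.trans (R.le_opNorm _)
      _ ≤ ‖R‖ * (2 * q ^ k) := by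
        gcongr
        refine (norm_add_le _ _).trans ?_
        rw [norm_smul, norm_smul, norm_e, norm_e, norm_zpow, norm_zpow, Complex.norm_real,
          Real.norm_of_nonneg hq0.le, neg_neg, zpow_add₀ hq0.ne', zpow_natCast, zpow_one]
        nlinarith [pow_pos hq0 k]
  have hlim : Tendsto (fun k : ℕ => ‖R‖ * (2 * q ^ k)) atTop (𝓝 0) := by
    simpa using ((tendsto_pow_atTop_nhds_zero_of_lt_one hq0.le hq1).const_mul 2).const_mul ‖R‖
  exact absurd (ge_of_tendsto' hlim hbound) (by norm_num)

/-- On the right half-line, vectors of bounded graph norm decay geometrically, uniformly. -/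
theorem norm_apply_natCast_le (hq0 : 0 < q) (hq1 : q < 1) (hext : A q ≤ T)
    (hsa : IsSelfAdjoint T) {z : ℂ} {M : ℝ} (x : T.domain) (hx : ‖(x : L2Z)‖ ≤ 1)
    (hf : ‖T x - z • (x : L2Z)‖ ≤ M) (n : ℕ) :
    ‖(x : L2Z) n‖ ≤ 4 * (1 + ‖z‖ + M) / (1 - q) ^ 2 * ((1 + q) / 2) ^ n := by
  have hM : 0 ≤ M := (norm_nonneg _).trans hf
  have hqc : (q : ℂ) ≠ 0 := by exact_mod_cast hq0.ne'
  refine le_mul_pow_of_two_step hq0 hq1 (by linarith [norm_nonneg z])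
    (u := fun n : ℕ => ‖(x : L2Z) n‖) ((norm_apply_le _ _).trans hx)
    ((norm_apply_le _ _).trans hx) (fun n => ?_) n
  have hT : ‖(T x) ((n : ℤ) + 1)‖ ≤ 1 + ‖z‖ + M := by
    refine (norm_apply_le _ _).trans ?_
    calc ‖T x‖ = ‖(T x - z • (x : L2Z)) + z • (x : L2Z)‖ := by rw [sub_add_cancel]
      _ ≤ ‖T x - z • (x : L2Z)‖ + ‖z‖ * ‖(x : L2Z)‖ := by
        rw [← norm_smul]; exact norm_add_le _ _
      _ ≤ 1 + ‖z‖ + M := by nlinarith [norm_nonneg z]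
  -- Coordinate `n + 1` of `T x`, multiplied by `q ^ (n + 1)`.
  have hrec : (x : L2Z) ((n : ℤ) + 2) =
      q ^ (n + 1) * (T x) ((n : ℤ) + 1) - q * (x : L2Z) n := by
    rw [extension_apply_apply hext hsa, zpow_add₀ hqc, zpow_neg, zpow_one,
      show ((n : ℤ) + 1) = ((n + 1 : ℕ) : ℤ) by push_cast; ring, zpow_natCast,
      show (((n + 1 : ℕ) : ℤ) - 1) = (n : ℤ) by push_cast; ring,
      show (((n + 1 : ℕ) : ℤ) + 1) = (n : ℤ) + 2 by push_cast; ring]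
    field_simp
    ring
  change ‖(x : L2Z) ((n : ℤ) + 2)‖ ≤ _
  rw [hrec]
  refine (norm_sub_le _ _).trans ?_
  rw [norm_mul, norm_mul, norm_pow, Complex.norm_real, Real.norm_of_nonneg hq0.le, add_comm,
    mul_comm (1 + ‖z‖ + M)]
  gcongr

/-- Both weights are at most `q ^ n.natAbs`; the weaker ratio `(1 + q) / 2` matches the decay on the
right. -/
theorem norm_extension_apply_neg_le (hq0 : 0 < q) (hq1 : q < 1) (hext : A q ≤ T)
    (hsa : IsSelfAdjoint T) (x : T.domain) (hx : ‖(x : L2Z)‖ ≤ 1) {n : ℤ} (hn : n < 0) :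
    ‖(T x) n‖ ≤ 2 * ((1 + q) / 2) ^ n.natAbs := by
  obtain ⟨k, rfl⟩ : ∃ k : ℕ, n = -k := ⟨n.natAbs, by omega⟩
  rw [extension_apply_apply hext hsa, neg_neg, Int.natAbs_neg, Int.natAbs_natCast]
  have hqk : q ^ k ≤ ((1 + q) / 2) ^ k := pow_le_pow_left₀ hq0.le (by linarith) k
  have h1 := (norm_apply_le (x : L2Z) (-k - 1)).trans hx
  have h2 := (norm_apply_le (x : L2Z) (-k + 1)).trans hx
  refine (norm_add_le _ _).trans ?_
  rw [norm_mul, norm_mul, norm_zpow, norm_zpow, Complex.norm_real, Real.norm_of_nonneg hq0.le,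
    zpow_add₀ hq0.ne', zpow_natCast, zpow_one]
  have hk := pow_pos hq0 k
  have h3 : q ^ k * q * ‖(x : L2Z) (-k - 1)‖ ≤ q ^ k * 1 * 1 := by gcongr
  have h4 : q ^ k * ‖(x : L2Z) (-k + 1)‖ ≤ q ^ k * 1 := by gcongr
  linarith

theorem isProperAt_of_ne_zero (hq0 : 0 < q) (hq1 : q < 1) (hext : A q ≤ T)
    (hsa : IsSelfAdjoint T) {z : ℂ} (hz : z ≠ 0) : IsProperAt T z := by
  intro x hx hlim
  set f : ℕ → L2Z := fun k => T (x k) - z • (x k : L2Z) with hf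
  obtain ⟨M, hM⟩ : ∃ M : ℝ, ∀ k, ‖f k‖ ≤ M := by
    obtain ⟨M, hM⟩ := (Metric.isBounded_range_of_tendsto f hlim).exists_norm_le
    exact ⟨M, fun k => hM _ ⟨k, rfl⟩⟩
  have hM0 : 0 ≤ M := (norm_nonneg _).trans (hM 0)
  have hneg : ∀ k, Memℓp (fun n : ℤ => if n < 0 then f k n else 0) 2 := fun k =>
    (lp.memℓp (f k)).mono' fun n => by split_ifs <;> simp
  -- Adding `z⁻¹ • v k` turns `x k` into `z⁻¹ • T (x k)` on the left and leaves it alone on the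
  -- right.
  let v : ℕ → L2Z := fun k => ⟨fun n : ℤ => if n < 0 then f k n else 0, hneg k⟩
  have hv_apply : ∀ k n, v k n = if n < 0 then f k n else 0 := fun k n => rfl
  have hv : Tendsto v atTop (𝓝 0) := by
    refine squeeze_zero_norm (fun k => ?_) (tendsto_zero_iff_norm_tendsto_zero.1 hlim)
    refine lp.norm_mono (by norm_num) fun n => ?_
    rw [hv_apply]
    split_ifs <;> simp [hf]
  -- The sum of the right and left decay constants, so as to dominate both.
  let D : ℝ := 4 * (1 + ‖z‖ + M) / (1 - q) ^ 2 + ‖z‖⁻¹ * 2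
  let r : ℝ := (1 + q) / 2
  have hr0 : 0 < r := by simp only [r]; linarith
  have hz0 : 0 < ‖z‖ := norm_pos_iff.2 hz
  have hcomp := lp.isCompact_setOf_norm_apply_le
    (summable_sq_mul_pow_natAbs D hr0.le (by simp only [r]; linarith : r < 1))
  have hmem : ∀ k, ((x k : L2Z) + z⁻¹ • v k) ∈
      {u : L2Z | ∀ n : ℤ, ‖u n‖ ≤ D * r ^ n.natAbs} := by
    intro k n
    rw [lp.coeFn_add, lp.coeFn_smul, Pi.add_apply, Pi.smul_apply, hv_apply, smul_eq_mul]
    have hrn := pow_pos hr0 n.natAbs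
    split_ifs with hn
    · have hval : (x k : L2Z) n + z⁻¹ * f k n = z⁻¹ * (T (x k)) n := by
        simp only [hf, lp.coeFn_sub, lp.coeFn_smul, Pi.sub_apply, Pi.smul_apply, smul_eq_mul]
        field_simp
        ring
      rw [hval, norm_mul, norm_inv]
      calc ‖z‖⁻¹ * ‖(T (x k)) n‖ ≤ ‖z‖⁻¹ * (2 * r ^ n.natAbs) := by
            gcongr
            exact norm_extension_apply_neg_le hq0 hq1 hext hsa (x k) (hx k) hn
        _ = ‖z‖⁻¹ * 2 * r ^ n.natAbs := by ring
        _ ≤ D * r ^ n.natAbs := by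
            gcongr
            exact le_add_of_nonneg_left (by positivity)
    · obtain ⟨m, rfl⟩ : ∃ m : ℕ, n = m := ⟨n.toNat, by omega⟩
      rw [mul_zero, add_zero]
      refine (norm_apply_natCast_le hq0 hq1 hext hsa (x k) (hx k) (hM k) m).trans ?_
      rw [Int.natAbs_natCast]
      change _ * r ^ m ≤ _
      gcongr
      exact le_add_of_nonneg_right (by positivity)
  obtain ⟨a, -, φ, hφ, ha⟩ := hcomp.tendsto_subseq hmem
  refine ⟨a, φ, hφ, ?_⟩
  have := ha.sub ((hv.comp hφ.tendsto_atTop).const_smul z⁻¹)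
  rw [smul_zero, sub_zero] at this
  refine this.congr fun k => ?_
  simp

end Extension

end JacobiA

end

theorem mainTheorem5 (q : ℝ) (hq0 : 0 < q) (hq1 : q < 1)
    (T : JacobiA.L2Z →ₗ.[ℂ] JacobiA.L2Z) (hext : JacobiA.A q ≤ T) (hsa : IsSelfAdjoint T) :
    UnboundedOperator.essSpec T = {0} ∧
    UnboundedOperator.contSpec T = {0} ∧
    (0 : ℂ) ∉ UnboundedOperator.pointSpec T := by
  have h0 := JacobiA.zero_notMem_pointSpec hq0 hq1 hext hsa
  have h0s := JacobiA.zero_mem_spec hq0 hq1 hext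
  have hdisc : ∀ z ∈ UnboundedOperator.spec T, z ≠ 0 → z ∈ UnboundedOperator.discreteSpec T :=
    fun z hz hz0 => UnboundedOperator.mem_discreteSpec_of_isProperAt hsa
      ((isOpen_ne.eventually_mem hz0).mono fun _ hw =>
        JacobiA.isProperAt_of_ne_zero hq0 hq1 hext hsa hw) hz
  refine ⟨Set.eq_singleton_iff_unique_mem.2 ⟨⟨h0s, fun h => h0 h.1⟩, fun z hz => ?_⟩,
    Set.eq_singleton_iff_unique_mem.2 ⟨⟨h0s, not_not.1 h0,
      UnboundedOperator.dense_range_of_notMem_pointSpec hsa h0⟩, fun z hz => ?_⟩, h0⟩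
  · by_contra hz0
    exact hz.2 (hdisc z hz.1 hz0)
  · by_contra hz0
    exact (hdisc z hz.1 hz0).1 hz.2.1
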